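/- Let $(\Omega,\mathcal F,\mathbb P)$ be a probability space, let $\xi_1,\xi_2,\dots$ be i.i.d. random elements of a measurable space $\Xi$ with law $P$, let $X$ be a nonempty set, and let $h:X\times\Xi\to\mathbb R$ be such that every section $h_x=h(x,\cdot)$ is measurable and $P$-integrable. Put $$f(x)=\int h_x\,dP,\quad \hat f_n(x)=\frac1n\sum_{i=1}^n h(x,\xi_i),\quad \psi^*=\inf_X f,\quad \hat\psi_n=\inf_X\hat f_n,$$ $$S^\varepsilon=\{x\in X: f(x)\le\psi^*+\varepsilon\},\qquad \hat S_n^\delta=\{x\in X:\hat f_n(x)\le\hat\psi_n+\delta\}.$$ Let $\ell^\infty(X)$ be the space of bounded real functions on $X$ with the supremum norm. For possibly nonmeasurable $U:\Omega\to[-\infty,\infty]$ let $\mathbb E^*U$ be the infimum of $\mathbb E[V]$ over measurable $V\ge U$ for which $\mathbb E[V]$ exists, and let $\mathbb P^*(A)=\mathbb E^*\mathbf 1_A$. Write $U_n=O_{\mathbb P^*}(r_n)$ if for every $\varepsilon>0$ there is $M<\infty$ with $\limsup_n\mathbb P^*(|U_n|>Mr_n)\le\varepsilon$. Weak convergence $Z_n\rightsquigarrow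 Z$ of possibly nonmeasurable maps is in the Hoffmann-Jørgensen sense: $Z$ is Borel measurable and $\mathbb E^*\varphi(Z_n)\to\mathbb E\varphi(Z)$ for every bounded continuous real function $\varphi$. **Corollary (Donsker theorem implications).** Assume that $f\in\ell^\infty(X)$, that for all sufficiently large $n$ almost surely $\hat f_n\in\ell^\infty(X)$, and that, for a Borel measurable random element $G$ of $\ell^\infty(X)$, $$\sqrt n(\hat f_n-f)\rightsquigarrow G\quad\text{in }\ell^\infty(X).$$ Then: 1. $\displaystyle\sqrt n(\hat\psi_n-\psi^*)\rightsquigarrow\lim_{\varepsilon\downarrow0}\inf_{x\in S^\varepsilon}G(x)$, where the limit on the right exists on every sample path. 2. $\hat\psi_n-\psi^*=O_{\mathbb P^*}(n^{-1/2})$. 3. Let $(\delta_n)$ be a nonnegative deterministic sequence with $\delta_n=O(n^{-1/2})$, and let $\hat x_n:\Omega\to X$ be maps for which there are events $A_1\subseteq A_2\subseteq\cdots$ with $\mathbb P(\bigcup_N A_N)=1$ such that $\hat x_n(\omega)\in\hat S_n^{\delta_n}(\omega)$ for all $N$, all $\omega\in A_N$ and all $n\ge N$. Then $f(\hat x_n)-\psi^*=O_{\mathbb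 P^*}(n^{-1/2})$. 4. If, in addition to the assumptions of 3, $X\subseteq\mathbb R^d$, $S^0\ne\varnothing$, and for some $\kappa\ge1$ and $\alpha>0$ $$f(x)-\psi^*\ge\alpha\,\operatorname{dist}(x,S^0)^\kappa\qquad\text{for all }x\in X$$ (Euclidean distance), then $\operatorname{dist}(\hat x_n,S^0)=O_{\mathbb P^*}(n^{-1/(2\kappa)})$. -/

import Mathlib

open MeasureTheory ProbabilityTheory Filter Topology
open scoped ENNReal BoundedContinuousFunction

/-! ### Outer expectation, outer probability, Hoffmann-Jørgensen weak convergence -/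

/-- The positive part of the integral of an extended real function, `∫ V⁺ dμ`. -/
noncomputable def posIntegral {Ω : Type*} [MeasurableSpace Ω] (μ : Measure Ω)
    (V : Ω → EReal) : ℝ≥0∞ :=
  ∫⁻ ω, (V ω).toENNReal ∂μ

/-- `E[V]` exists: at least one of `∫ V⁺` and `∫ V⁻` is finite. -/
def ExpectationExists {Ω : Type*} [MeasurableSpace Ω] (μ : Measure Ω) (V : Ω → EReal) : Prop :=
  posIntegral μ V ≠ ⊤ ∨ posIntegral μ (fun ω => -V ω) ≠ ⊤

/-- `E[V] = ∫ V⁺ - ∫ V⁻`, as an extended real number. -/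
noncomputable def extExpectation {Ω : Type*} [MeasurableSpace Ω] (μ : Measure Ω)
    (V : Ω → EReal) : EReal :=
  (posIntegral μ V : EReal) - (posIntegral μ (fun ω => -V ω) : EReal)

/-- The outer expectation `E* U` of a possibly nonmeasurable map `U` into the extended reals:
the infimum of `E[V]` over the measurable `V ≥ U` for which `E[V]` exists. -/
noncomputable def outerExpectation {Ω : Type*} [MeasurableSpace Ω] (μ : Measure Ω)
    (U : Ω → EReal) : EReal :=
  sInf {a : EReal | ∃ V : Ω → EReal, Measurable V ∧ (∀ ω, U ω ≤ V ω) ∧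
    ExpectationExists μ V ∧ a = extExpectation μ V}

/-- The outer probability `P*(A) = E* 1_A` of an arbitrary set `A`. -/
noncomputable def outerProb {Ω : Type*} [MeasurableSpace Ω] (μ : Measure Ω)
    (A : Set Ω) : EReal :=
  outerExpectation μ (A.indicator fun _ => 1)

/-- Outer probability is the value of the measure, which Mathlib extends to all sets by the
infimum over measurable supersets. -/
theorem outerProb_eq {Ω : Type*} [MeasurableSpace Ω] (μ : Measure Ω) (A : Set Ω) :
    outerProb μ A = (μ A : EReal) := by
  have one : (1 : EReal).toENNReal = 1 := by
    simpa using EReal.toENNReal_coe (x := 1)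
  have key : ∀ V : Ω → EReal, (∀ ω, 0 ≤ V ω) → posIntegral μ (fun ω => -V ω) = 0 := by
    intro V hV
    have h0 : ∀ ω, (-V ω).toENNReal = 0 := fun ω =>
      EReal.toENNReal_of_nonpos (by simpa using hV ω)
    simp [posIntegral, h0]
  apply le_antisymm
  · refine sInf_le ⟨(toMeasurable μ A).indicator fun _ => 1,
      measurable_const.indicator (measurableSet_toMeasurable μ A), ?_, ?_, ?_⟩
    · intro ω
      exact Set.indicator_le_indicator_of_subset (subset_toMeasurable μ A)
        (fun _ => zero_le_one) ω
    · right
      rw [key _ (fun ω => Set.indicator_nonneg (fun _ _ => zero_le_one) ω)]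
      exact ENNReal.zero_ne_top
    · rw [extExpectation, key _ (fun ω => Set.indicator_nonneg (fun _ _ => zero_le_one) ω)]
      have h1 : posIntegral μ ((toMeasurable μ A).indicator fun _ => 1) = μ A := by
        have h2 : ∀ ω, ((toMeasurable μ A).indicator (fun _ => (1 : EReal)) ω).toENNReal
            = (toMeasurable μ A).indicator (fun _ => (1 : ℝ≥0∞)) ω := by
          intro ω
          by_cases h : ω ∈ toMeasurable μ A <;> simp [h, one]
        simp only [posIntegral, h2]
        rw [lintegral_indicator (measurableSet_toMeasurable μ A)]
        simp [measure_toMeasurable]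
      rw [h1]
      simp
  · refine le_sInf ?_
    rintro a ⟨V, hVm, hV, -, rfl⟩
    have hV0 : ∀ ω, 0 ≤ V ω := fun ω =>
      (Set.indicator_nonneg (fun _ _ => zero_le_one) ω).trans (hV ω)
    rw [extExpectation, key V hV0]
    have h1 : μ A ≤ posIntegral μ V := by
      have hm : Measurable fun ω => (V ω).toENNReal := measurable_ereal_toENNReal.comp hVm
      calc μ A ≤ μ {ω | 1 ≤ (V ω).toENNReal} := by
            refine measure_mono fun ω hω => ?_
            have h2 := hV ω
            rw [Set.indicator_of_mem hω] at h2
            have h3 := EReal.toENNReal_le_toENNReal h2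
            simpa [one] using h3
        _ ≤ posIntegral μ V := by
            simpa [posIntegral] using mul_meas_ge_le_lintegral hm 1
    simpa using h1

/-- `U_n = O_{P*}(r_n)`: for every `ε > 0` there is a finite `M` with
`limsup_n P*(|U_n| > M r_n) ≤ ε`. -/
def IsBigOPStar {Ω : Type*} [MeasurableSpace Ω] (μ : Measure Ω)
    (U : ℕ → Ω → ℝ) (r : ℕ → ℝ) : Prop :=
  ∀ ε : ℝ, 0 < ε → ∃ M : ℝ,
    limsup (fun n => outerProb μ {ω | M * r n < |U n ω|}) atTop ≤ (ε : EReal)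

/-- Weak convergence `Z_n ⇝ G` in the Hoffmann-Jørgensen sense: the limit `G` is Borel measurable
and `E* φ(Z_n) → E φ(G)` for every bounded continuous real function `φ`. The maps `Z_n` need not
be measurable, and `G` may live on another probability space. -/
def HJWeakConv {Ω Ω' E : Type*} [MeasurableSpace Ω] [MeasurableSpace Ω'] [TopologicalSpace E]
    (μ : Measure Ω) (Z : ℕ → Ω → E) (ν : Measure Ω') (G : Ω' → E) : Prop :=
  Measurable[_, borel E] G ∧
    ∀ φ : E →ᵇ ℝ,
      Tendsto (fun n => outerExpectation μ (fun ω => ((φ (Z n ω) : ℝ) : EReal))) atTop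
        (𝓝 ((∫ ω', φ (G ω') ∂ν : ℝ) : EReal))

/-! ### Bounded functions, infima and near-minimizers -/

/-- The Banach space `ℓ^∞(X)` of bounded real functions on `X` with the supremum norm. -/
abbrev EllInfty (X : Type*) : Type _ := lp (fun _ : X => ℝ) ⊤

/-- A real function on `X` regarded as an element of `ℓ^∞(X)`. For unbounded functions, where this
makes no sense, the value is `0`. -/
noncomputable def toEllInfty {X : Type*} (g : X → ℝ) : EllInfty X :=
  open Classical in if hg : Memℓp g ⊤ then ⟨g, hg⟩ else 0

/-- The infimum functional `ι(g) = inf_{x ∈ X} g(x)`. -/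
noncomputable def infVal {X : Type*} (g : X → ℝ) : ℝ := ⨅ x, g x

/-- The `ε`-minimizers of `g`. -/
def nearMin {X : Type*} (g : X → ℝ) (ε : ℝ) : Set X := {x | g x ≤ infVal g + ε}

/-- Sharp growth of order `κ ≥ 1`. Here `e` is the inclusion of `X` into `ℝ^d`; there is an exact
minimizer, and `f(x) - ι(f) ≥ α dist(x, S^0)^κ` for some `α > 0` and all `x`. -/
def SharpGrowth {X : Type*} {d : ℕ} (e : X → EuclideanSpace ℝ (Fin d)) (f : X → ℝ)
    (κ : ℝ) : Prop :=
  1 ≤ κ ∧ (nearMin f 0).Nonempty ∧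
    ∃ α : ℝ, 0 < α ∧ ∀ x, α * Metric.infDist (e x) (e '' nearMin f 0) ^ κ ≤ f x - infVal f

/-! ### Expected and empirical objectives -/

/-- The expected objective `f(x) = P h_x`. -/
noncomputable def expObj {X Ξ : Type*} [MeasurableSpace Ξ] (h : X → Ξ → ℝ) (P : Measure Ξ) :
    X → ℝ :=
  fun x => ∫ z, h x z ∂P

/-- The empirical objective `(1/n) ∑ h(x, ξ_i)` over the first `n` sample points; the sample
`ξ_1, ξ_2, …` is indexed from `0`. -/
noncomputable def empObj {X Ξ Ω : Type*} (h : X → Ξ → ℝ) (ξ : ℕ → Ω → Ξ) (n : ℕ) (ω : Ω) :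
    X → ℝ :=
  fun x => (1 / (n : ℝ)) * ∑ i ∈ Finset.range n, h x (ξ i ω)

/-- Empirical minimizer membership: there are increasing events `A_N` whose union has probability
one, such that `x̂_n(ω)` is a `δ_n`-minimizer of the `n`-th empirical objective whenever
`ω ∈ A_N` and `n ≥ N`. -/
def EmpMinMembership {X Ξ Ω : Type*} [MeasurableSpace Ω] (μ : Measure Ω) (h : X → Ξ → ℝ)
    (ξ : ℕ → Ω → Ξ) (δ : ℕ → ℝ) (xhat : ℕ → Ω → X) : Prop :=
  ∃ A : ℕ → Set Ω, (∀ N, MeasurableSet (A N)) ∧ (∀ N, A N ⊆ A (N + 1)) ∧ μ (⋃ N, A N) = 1 ∧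
    ∀ N, ∀ ω ∈ A N, ∀ n, N ≤ n → xhat n ω ∈ nearMin (empObj h ξ n ω) (δ n)

/-!
With `z = c (g - f)` for a scale `c > 0`, the rescaled change `c (inf g - inf f)` of the infimum is
the penalized infimum `inf_x (c (f x - inf f) + z x)`. At fixed `z` this increases with `c` to
`lim_{ε ↓ 0} inf_{S^ε} z`, and both the penalized infimum and its limit are `1`-Lipschitz in `z`.
Hence, once `c_n ≥ m`, the rescaled optimal value lies between two continuous functionals of
`Z_n = c_n (f̂_n - f)` whose gap tends to zero as `m → ∞`. The oscillation of a test function over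
the interval between them is a bounded continuous function of `Z_n`, so the weak convergence of
`Z_n` controls it. The rates follow since a weakly convergent sequence is bounded in outer
probability.
-/

/-! ### The outer expectation of bounded functions -/

section UpperMean

variable {Ω : Type*} [MeasurableSpace Ω] {μ : Measure Ω}

/-- The outer expectation of a real function, as a real number. It is meant for bounded functions
and finite measures, where the outer expectation is finite. -/
noncomputable def upperMean (μ : Measure Ω) (U : Ω → ℝ) : ℝ :=
  (outerExpectation μ fun ω => (U ω : EReal)).toReal

theorem posIntegral_coe (V : Ω → ℝ) :
    posIntegral μ (fun ω => (V ω : EReal)) = ∫⁻ ω, ENNReal.ofReal (V ω) ∂μ := by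
  simp only [posIntegral, EReal.real_coe_toENNReal]

theorem extExpectation_coe {V : Ω → ℝ} (hV : Integrable V μ) :
    extExpectation μ (fun ω => (V ω : EReal)) = ((∫ ω, V ω ∂μ : ℝ) : EReal) := by
  have hneg : posIntegral μ (fun ω => -(V ω : EReal)) = ∫⁻ ω, ENNReal.ofReal (-V ω) ∂μ := by
    simp only [← posIntegral_coe, EReal.coe_neg]
  have hneg_ne_top : ∫⁻ ω, ENNReal.ofReal (-V ω) ∂μ ≠ ⊤ := hV.neg.lintegral_lt_top.ne
  rw [extExpectation, posIntegral_coe, hneg,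
    integral_eq_lintegral_pos_part_sub_lintegral_neg_part hV, EReal.coe_sub,
    EReal.coe_ennreal_toReal hV.lintegral_lt_top.ne, EReal.coe_ennreal_toReal hneg_ne_top]

theorem extExpectation_mono {V W : Ω → EReal} (h : ∀ ω, V ω ≤ W ω) :
    extExpectation μ V ≤ extExpectation μ W := by
  refine EReal.sub_le_sub (EReal.coe_ennreal_le_coe_ennreal_iff.2 ?_)
    (EReal.coe_ennreal_le_coe_ennreal_iff.2 ?_)
  · exact lintegral_mono fun ω => EReal.toENNReal_le_toENNReal (h ω)
  · exact lintegral_mono fun ω => EReal.toENNReal_le_toENNReal (EReal.neg_le_neg_iff.2 (h ω))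

theorem outerExpectation_coe_le_integral {U V : Ω → ℝ} (hVm : Measurable V)
    (hV : Integrable V μ) (hUV : ∀ ω, U ω ≤ V ω) :
    outerExpectation μ (fun ω => (U ω : EReal)) ≤ ((∫ ω, V ω ∂μ : ℝ) : EReal) := by
  refine sInf_le ⟨fun ω => (V ω : EReal), hVm.coe_real_ereal,
    fun ω => EReal.coe_le_coe_iff.2 (hUV ω), Or.inl ?_, (extExpectation_coe hV).symm⟩
  rw [posIntegral_coe]
  exact hV.lintegral_lt_top.ne

theorem upperMean_indicator_one (A : Set Ω) :
    upperMean μ (A.indicator fun _ => 1) = μ.real A := by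
  have hcoe : (fun ω => ((A.indicator (fun _ => 1) ω : ℝ) : EReal)) = A.indicator fun _ => 1 := by
    ext ω
    by_cases hω : ω ∈ A <;> simp [hω]
  rw [upperMean, hcoe, ← outerProb, outerProb_eq, EReal.toReal_coe_ennreal, Measure.real]

variable [IsFiniteMeasure μ]

theorem integrable_of_abs_le {V : Ω → ℝ} (hV : Measurable V) {C : ℝ} (h : ∀ ω, |V ω| ≤ C) :
    Integrable V μ :=
  .of_bound hV.aestronglyMeasurable C (.of_forall h)

theorem le_outerExpectation_coe {U : Ω → ℝ} {C a : ℝ} (hU : ∀ ω, |U ω| ≤ C)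
    (ha : ∀ V : Ω → ℝ, Measurable V → (∀ ω, U ω ≤ V ω) → (∀ ω, |V ω| ≤ C) → a ≤ ∫ ω, V ω ∂μ) :
    (a : EReal) ≤ outerExpectation μ fun ω => (U ω : EReal) := by
  refine le_sInf ?_
  rintro _ ⟨V, hVm, hUV, -, rfl⟩
  have hU_le : ∀ ω, (U ω : EReal) ≤ min (V ω) C := fun ω =>
    le_min (hUV ω) (EReal.coe_le_coe_iff.2 (abs_le.1 (hU ω)).2)
  have hcoe : ∀ ω, (((min (V ω) C).toReal : ℝ) : EReal) = min (V ω) C := fun ω =>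
    EReal.coe_toReal (ne_top_of_le_ne_top (EReal.coe_ne_top C) (min_le_right _ _))
      (ne_bot_of_le_ne_bot (EReal.coe_ne_bot _) (hU_le ω))
  have hU_le' : ∀ ω, U ω ≤ (min (V ω) C).toReal := fun ω => by
    rw [← EReal.coe_le_coe_iff, hcoe]
    exact hU_le ω
  have hle_C : ∀ ω, (min (V ω) C).toReal ≤ C := fun ω => by
    rw [← EReal.coe_le_coe_iff, hcoe]
    exact min_le_right _ _
  have hm : Measurable fun ω => (min (V ω) C).toReal := (hVm.min measurable_const).ereal_toReal
  have habs : ∀ ω, |(min (V ω) C).toReal| ≤ C := fun ω =>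
    abs_le.2 ⟨(abs_le.1 (hU ω)).1.trans (hU_le' ω), hle_C ω⟩
  calc (a : EReal) ≤ ((∫ ω, (min (V ω) C).toReal ∂μ : ℝ) : EReal) :=
        EReal.coe_le_coe_iff.2 (ha _ hm hU_le' habs)
    _ = extExpectation μ fun ω => (((min (V ω) C).toReal : ℝ) : EReal) :=
        (extExpectation_coe (integrable_of_abs_le hm habs)).symm
    _ ≤ extExpectation μ V := extExpectation_mono fun ω => (hcoe ω).trans_le (min_le_left _ _)

theorem lintegral_ofReal_const_sub_ne_top {U : Ω → ℝ} {C : ℝ} (hU : ∀ ω, |U ω| ≤ C) :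
    ∫⁻ ω, ENNReal.ofReal (C - U ω) ∂μ ≠ ⊤ := by
  refine ne_top_of_le_ne_top
    (ENNReal.mul_ne_top (ENNReal.ofReal_ne_top (r := 2 * C)) (measure_ne_top μ Set.univ)) ?_
  rw [← lintegral_const]
  exact lintegral_mono fun ω => ENNReal.ofReal_le_ofReal (by linarith [abs_le.1 (hU ω)])

theorem integral_eq_mul_sub_lintegral {V : Ω → ℝ} (hVm : Measurable V) {C : ℝ}
    (hV : ∀ ω, |V ω| ≤ C) :
    ∫ ω, V ω ∂μ = C * μ.real Set.univ - (∫⁻ ω, ENNReal.ofReal (C - V ω) ∂μ).toReal := by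
  rw [← integral_eq_lintegral_of_nonneg_ae
    (.of_forall fun ω => sub_nonneg.2 (abs_le.1 (hV ω)).2)
    (measurable_const.sub hVm).aestronglyMeasurable,
    integral_sub (integrable_const C) (integrable_of_abs_le hVm hV), integral_const, smul_eq_mul]
  ring

/-- `∫⁻` of a nonmeasurable function is its lower integral, whence this reflection formula. -/
theorem outerExpectation_coe {U : Ω → ℝ} {C : ℝ} (hU : ∀ ω, |U ω| ≤ C) :
    outerExpectation μ (fun ω => (U ω : EReal)) =
      ((C * μ.real Set.univ - (∫⁻ ω, ENNReal.ofReal (C - U ω) ∂μ).toReal : ℝ) : EReal) := by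
  apply le_antisymm
  · obtain ⟨g, hgm, hg, hg_lintegral⟩ :=
      exists_measurable_le_lintegral_eq μ fun ω => ENNReal.ofReal (C - U ω)
    have hg_le : ∀ ω, (g ω).toReal ≤ C - U ω := fun ω =>
      ENNReal.toReal_le_of_le_ofReal (sub_nonneg.2 (abs_le.1 (hU ω)).2) (hg ω)
    have hg_ne_top : ∀ ω, g ω ≠ ⊤ := fun ω => ne_top_of_le_ne_top ENNReal.ofReal_ne_top (hg ω)
    have hm : Measurable fun ω => C - (g ω).toReal := measurable_const.sub hgm.ennreal_toReal
    have habs : ∀ ω, |C - (g ω).toReal| ≤ C := fun ω => abs_le.2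
      ⟨by linarith [hg_le ω, abs_le.1 (hU ω)], sub_le_self _ ENNReal.toReal_nonneg⟩
    refine (outerExpectation_coe_le_integral hm (integrable_of_abs_le hm habs)
      fun ω => le_sub_comm.1 (hg_le ω)).trans_eq ?_
    simp only [integral_eq_mul_sub_lintegral hm habs, hg_lintegral, sub_sub_cancel,
      ENNReal.ofReal_toReal (hg_ne_top _)]
  · refine le_outerExpectation_coe hU fun V hVm hUV hV => ?_
    rw [integral_eq_mul_sub_lintegral hVm hV]
    exact sub_le_sub_left (ENNReal.toReal_mono (lintegral_ofReal_const_sub_ne_top hU)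
      (lintegral_mono fun ω => ENNReal.ofReal_le_ofReal (sub_le_sub_left (hUV ω) _))) _

theorem upperMean_eq {U : Ω → ℝ} {C : ℝ} (hU : ∀ ω, |U ω| ≤ C) :
    upperMean μ U = C * μ.real Set.univ - (∫⁻ ω, ENNReal.ofReal (C - U ω) ∂μ).toReal := by
  rw [upperMean, outerExpectation_coe hU, EReal.toReal_coe]

theorem coe_upperMean {U : Ω → ℝ} {C : ℝ} (hU : ∀ ω, |U ω| ≤ C) :
    (upperMean μ U : EReal) = outerExpectation μ fun ω => (U ω : EReal) := by
  rw [upperMean_eq hU, outerExpectation_coe hU]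

theorem upperMean_mono_ae {U V : Ω → ℝ} {C D : ℝ} (hU : ∀ ω, |U ω| ≤ C) (hV : ∀ ω, |V ω| ≤ D)
    (h : ∀ᵐ ω ∂μ, U ω ≤ V ω) : upperMean μ U ≤ upperMean μ V := by
  have hU' : ∀ ω, |U ω| ≤ max C D := fun ω => (hU ω).trans (le_max_left _ _)
  have hV' : ∀ ω, |V ω| ≤ max C D := fun ω => (hV ω).trans (le_max_right _ _)
  rw [upperMean_eq hU', upperMean_eq hV']
  refine sub_le_sub_left (ENNReal.toReal_mono (lintegral_ofReal_const_sub_ne_top hU') ?_) _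
  exact lintegral_mono_ae (h.mono fun ω hω => ENNReal.ofReal_le_ofReal (sub_le_sub_left hω _))

theorem upperMean_add_le {U V : Ω → ℝ} {C D : ℝ} (hU : ∀ ω, |U ω| ≤ C) (hV : ∀ ω, |V ω| ≤ D) :
    upperMean μ (fun ω => U ω + V ω) ≤ upperMean μ U + upperMean μ V := by
  have hUV : ∀ ω, |U ω + V ω| ≤ C + D := fun ω =>
    (abs_add_le _ _).trans (add_le_add (hU ω) (hV ω))
  have hsuper : ∫⁻ ω, ENNReal.ofReal (C - U ω) ∂μ + ∫⁻ ω, ENNReal.ofReal (D - V ω) ∂μ ≤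
      ∫⁻ ω, ENNReal.ofReal (C + D - (U ω + V ω)) ∂μ := by
    refine (le_lintegral_add _ _).trans (lintegral_mono fun ω => ?_)
    rw [← ENNReal.ofReal_add (by linarith [abs_le.1 (hU ω)]) (by linarith [abs_le.1 (hV ω)])]
    exact ENNReal.ofReal_le_ofReal (by linarith)
  have hsuper' := ENNReal.toReal_mono (lintegral_ofReal_const_sub_ne_top hUV) hsuper
  rw [ENNReal.toReal_add (lintegral_ofReal_const_sub_ne_top hU)
    (lintegral_ofReal_const_sub_ne_top hV)] at hsuper'
  rw [upperMean_eq hU, upperMean_eq hV, upperMean_eq hUV]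
  linarith

theorem abs_upperMean_sub_le {U V B : Ω → ℝ} {C D K : ℝ} (hU : ∀ ω, |U ω| ≤ C)
    (hV : ∀ ω, |V ω| ≤ D) (hB : ∀ ω, |B ω| ≤ K) (h : ∀ᵐ ω ∂μ, |U ω - V ω| ≤ B ω) :
    |upperMean μ U - upperMean μ V| ≤ upperMean μ B := by
  have le_add : ∀ {U V : Ω → ℝ} {C D : ℝ}, (∀ ω, |U ω| ≤ C) → (∀ ω, |V ω| ≤ D) →
      (∀ᵐ ω ∂μ, |U ω - V ω| ≤ B ω) → upperMean μ U ≤ upperMean μ V + upperMean μ B := by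
    intro U V C D hU hV h
    have hVB : ∀ ω, |V ω + B ω| ≤ D + K := fun ω =>
      (abs_add_le _ _).trans (add_le_add (hV ω) (hB ω))
    refine (upperMean_mono_ae hU hVB ?_).trans (upperMean_add_le hV hB)
    filter_upwards [h] with ω hω
    linarith [(abs_le.1 hω).2]
  refine abs_sub_le_iff.2 ⟨sub_le_iff_le_add'.2 (le_add hU hV h), sub_le_iff_le_add'.2 ?_⟩
  exact le_add hV hU (by simpa only [abs_sub_comm] using h)

theorem measureReal_le_upperMean {A : Set Ω} {V : Ω → ℝ} {C : ℝ} (hV : ∀ ω, |V ω| ≤ C)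
    (hV_nonneg : ∀ ω, 0 ≤ V ω) (hAV : ∀ ω ∈ A, 1 ≤ V ω) : μ.real A ≤ upperMean μ V := by
  rw [← upperMean_indicator_one]
  refine upperMean_mono_ae (C := 1) (fun ω => ?_) hV
    (.of_forall fun ω => Set.indicator_le' hAV (fun ω _ => hV_nonneg ω) ω)
  by_cases hω : ω ∈ A <;> simp [hω]

end UpperMean

/-! ### Weak convergence -/

section SegmentOscillation

variable {E F : Type*} [AddCommGroup E] [Module ℝ E] [TopologicalSpace E]
  [IsTopologicalAddGroup E] [ContinuousSMul ℝ E] [SeminormedAddCommGroup F]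

/-- The deviation of `φ` from its value at the endpoint `b`, at time `s ∈ [0, 1]` along the segment
from `a` to `b`. -/
def segmentDeviation (φ : E →ᵇ F) : C((E × E) × unitInterval, F) :=
  ⟨fun p => φ (p.1.1 + (p.2 : ℝ) • (p.1.2 - p.1.1)) - φ p.1.2, by fun_prop⟩

/-- The function `(a, b) ↦ sup {‖φ w - φ b‖ : w ∈ [a, b]}`, encoded as the norm of the curried
deviation, which makes its continuity evident. -/
noncomputable def segmentOscillation (φ : E →ᵇ F) : E × E →ᵇ ℝ :=
  BoundedContinuousFunction.ofNormedAddCommGroup (fun p => ‖(segmentDeviation φ).curry p‖)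
    (segmentDeviation φ).curry.continuous.norm (2 * ‖φ‖) fun p => by
      rw [norm_norm, ContinuousMap.norm_le_of_nonempty]
      exact fun s => (dist_eq_norm _ _).symm.trans_le (φ.dist_le_two_norm _ _)

theorem segmentOscillation_self (φ : E →ᵇ F) (b : E) : segmentOscillation φ (b, b) = 0 := by
  have hdev : ∀ s, (segmentDeviation φ).curry (b, b) s = 0 := fun s => by
    simp [segmentDeviation]
  exact le_antisymm ((ContinuousMap.norm_le_of_nonempty _).2 fun s => by simp [hdev])
    (norm_nonneg ((segmentDeviation φ).curry (b, b)))

theorem norm_sub_le_segmentOscillation (φ : E →ᵇ F) {a b w : E} (hw : w ∈ segment ℝ a b) :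
    ‖φ w - φ b‖ ≤ segmentOscillation φ (a, b) := by
  rw [segment_eq_image'] at hw
  obtain ⟨s, hs, rfl⟩ := hw
  exact ((segmentDeviation φ).curry (a, b)).norm_coe_le_norm ⟨s, hs⟩

end SegmentOscillation

section WeakConvergence

variable {Ω Ω' E F : Type*} [MeasurableSpace Ω] [MeasurableSpace Ω'] [TopologicalSpace E]
  [TopologicalSpace F] {μ : Measure Ω} {ν : Measure Ω'} {Z : ℕ → Ω → E} {G : Ω' → E}

theorem HJWeakConv.comp_continuous (hZ : HJWeakConv μ Z ν G) {g : E → F} (hg : Continuous g) :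
    HJWeakConv μ (fun n ω => g (Z n ω)) ν fun ω' => g (G ω') := by
  refine ⟨?_, fun φ => hZ.2 (φ.compContinuous ⟨g, hg⟩)⟩
  borelize E F
  exact hg.measurable.comp hZ.1

variable [IsFiniteMeasure μ]

theorem hjWeakConv_iff : HJWeakConv μ Z ν G ↔ Measurable[_, borel E] G ∧ ∀ φ : E →ᵇ ℝ,
    Tendsto (fun n => upperMean μ fun ω => φ (Z n ω)) atTop (𝓝 (∫ ω', φ (G ω') ∂ν)) :=
  and_congr_right fun _ => forall_congr' fun φ => by
    simp_rw [← coe_upperMean fun ω => φ.norm_coe_le_norm (Z _ ω), EReal.tendsto_coe]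

variable [IsFiniteMeasure ν]

theorem HJWeakConv.exists_eventually_upperMean_lt (hZ : HJWeakConv μ Z ν G) {β : ℕ → E →ᵇ ℝ}
    {C : ℝ} (hβ_le : ∀ m z, |β m z| ≤ C) (hβ : ∀ z, Tendsto (fun m => β m z) atTop (𝓝 0))
    {ε : ℝ} (hε : 0 < ε) : ∃ m, ∀ᶠ n in atTop, upperMean μ (fun ω => β m (Z n ω)) < ε := by
  obtain ⟨hG, hZ⟩ := hjWeakConv_iff.1 hZ
  have hmeas : ∀ m, AEStronglyMeasurable (fun ω' => β m (G ω')) ν := fun m => by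
    borelize E
    exact ((β m).continuous.measurable.comp hG).aestronglyMeasurable
  have hlim : Tendsto (fun m => ∫ ω', β m (G ω') ∂ν) atTop (𝓝 (∫ _, 0 ∂ν)) :=
    tendsto_integral_of_dominated_convergence (fun _ => C) hmeas (integrable_const C)
      (fun m => .of_forall fun ω' => hβ_le m _) (.of_forall fun ω' => hβ _)
  rw [integral_zero] at hlim
  obtain ⟨m, hm⟩ := (hlim.eventually_lt_const hε).exists
  exact ⟨m, (hZ (β m)).eventually_lt_const hm⟩

theorem HJWeakConv.of_eventually_mem_segment [AddCommGroup F] [Module ℝ F]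
    [IsTopologicalAddGroup F] [ContinuousSMul ℝ F] (hZ : HJWeakConv μ Z ν G)
    {W : ℕ → Ω → F} {Φ : ℕ → E → F} {Λ : E → F} (hΦ : ∀ m, Continuous (Φ m)) (hΛ : Continuous Λ)
    (hlim : ∀ z, Tendsto (fun m => Φ m z) atTop (𝓝 (Λ z)))
    (hW : ∀ m, ∀ᶠ n in atTop, ∀ᵐ ω ∂μ, W n ω ∈ segment ℝ (Φ m (Z n ω)) (Λ (Z n ω))) :
    HJWeakConv μ W ν fun ω' => Λ (G ω') := by
  obtain ⟨hΛG, hΛZ⟩ := hjWeakConv_iff.1 (hZ.comp_continuous hΛ)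
  refine hjWeakConv_iff.2 ⟨hΛG, fun φ => ?_⟩
  let β (m : ℕ) : E →ᵇ ℝ :=
    (segmentOscillation φ).compContinuous ⟨fun z => (Φ m z, Λ z), (hΦ m).prodMk hΛ⟩
  have hβ_le : ∀ m z, |β m z| ≤ ‖segmentOscillation φ‖ := fun m z =>
    (segmentOscillation φ).norm_coe_le_norm _
  have hβ : ∀ z, Tendsto (fun m => β m z) atTop (𝓝 0) := fun z => by
    rw [← segmentOscillation_self φ (Λ z)]
    exact ((segmentOscillation φ).continuous.tendsto _).comp
      ((hlim z).prodMk_nhds tendsto_const_nhds)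
  have hdiff : Tendsto (fun n => (upperMean μ fun ω => φ (W n ω)) -
      upperMean μ fun ω => φ (Λ (Z n ω))) atTop (𝓝 0) := by
    refine Metric.tendsto_nhds.2 fun ε hε => ?_
    obtain ⟨m, hm⟩ := hZ.exists_eventually_upperMean_lt hβ_le hβ hε
    filter_upwards [hm, hW m] with n hn hWn
    rw [dist_zero_right]
    refine (abs_upperMean_sub_le (fun ω => φ.norm_coe_le_norm _) (fun ω => φ.norm_coe_le_norm _)
      (fun ω => hβ_le m _) ?_).trans_lt hn
    exact hWn.mono fun ω hω => norm_sub_le_segmentOscillation φ hω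
  simpa only [sub_add_cancel, zero_add] using hdiff.add (hΛZ φ)

end WeakConvergence

/-! ### Boundedness in outer probability -/

section BoundedInProbability

variable {Ω : Type*} [MeasurableSpace Ω] {μ : Measure Ω} [IsFiniteMeasure μ]

theorem outerProb_le_coe_iff {A : Set Ω} {a : ℝ} :
    outerProb μ A ≤ (a : EReal) ↔ μ.real A ≤ a := by
  rw [outerProb_eq, ← EReal.coe_ennreal_toReal (measure_ne_top μ A), EReal.coe_le_coe_iff,
    Measure.real]

theorem isBigOPStar_iff {U : ℕ → Ω → ℝ} {r : ℕ → ℝ} :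
    IsBigOPStar μ U r ↔
      ∀ ε : ℝ, 0 < ε → ∃ M : ℝ, ∀ᶠ n in atTop, μ.real {ω | M * r n < |U n ω|} ≤ ε := by
  refine ⟨fun h ε hε => ?_, fun h ε hε => ?_⟩
  · obtain ⟨M, hM⟩ := h (ε / 2) (half_pos hε)
    have hlt := hM.trans_lt (EReal.coe_lt_coe_iff.2 (half_lt_self hε))
    exact ⟨M, (eventually_lt_of_limsup_lt hlt).mono fun n hn => outerProb_le_coe_iff.1 hn.le⟩
  · obtain ⟨M, hM⟩ := h ε hε
    exact ⟨M, limsup_le_of_le (h := hM.mono fun n hn => outerProb_le_coe_iff.2 hn)⟩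

theorem HJWeakConv.isBigOPStar_norm {Ω' E : Type*} [MeasurableSpace Ω'] {ν : Measure Ω'}
    [IsFiniteMeasure ν] [SeminormedAddCommGroup E] {Z : ℕ → Ω → E} {G : Ω' → E}
    (hZ : HJWeakConv μ Z ν G) : IsBigOPStar μ (fun n ω => ‖Z n ω‖) fun _ => 1 := by
  have hnonneg : ∀ (m : ℕ) (z : E), 0 ≤ min 1 (‖z‖ / (m + 1)) := fun m z => by positivity
  have hle_one : ∀ (m : ℕ) (z : E), |min 1 (‖z‖ / (m + 1))| ≤ 1 := fun m z => by
    rw [abs_of_nonneg (hnonneg m z)]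
    exact min_le_left _ _
  let β (m : ℕ) : E →ᵇ ℝ := BoundedContinuousFunction.ofNormedAddCommGroup
    (fun z => min 1 (‖z‖ / (m + 1))) (by fun_prop) 1 (hle_one m)
  have hβ : ∀ z, Tendsto (fun m => β m z) atTop (𝓝 0) := fun z =>
    squeeze_zero (fun m => hnonneg m z) (fun m => min_le_right _ _)
      (tendsto_const_nhds.div_atTop
        (tendsto_atTop_add_const_right _ 1 tendsto_natCast_atTop_atTop))
  refine isBigOPStar_iff.2 fun ε hε => ?_
  obtain ⟨m, hm⟩ := hZ.exists_eventually_upperMean_lt (β := β) hle_one hβ hε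
  refine ⟨m + 1, hm.mono fun n hn => (measureReal_le_upperMean (fun ω => hle_one m _)
    (fun ω => hnonneg m _) fun ω hω => ?_).trans hn.le⟩
  rw [Set.mem_ofPred_eq, mul_one, abs_norm] at hω
  exact le_min le_rfl ((one_le_div (by positivity)).2 hω.le)

theorem IsBigOPStar.of_abs_le {U V : ℕ → Ω → ℝ} (hU : IsBigOPStar μ U fun _ => 1) {s : ℕ → ℝ}
    (hs : ∀ᶠ n in atTop, 0 ≤ s n) {a C : ℝ} (ha : 0 ≤ a) {B : ℕ → Set Ω}
    (hB : Tendsto (fun n => μ.real (B n)) atTop (𝓝 0))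
    (hV : ∀ᶠ n in atTop, ∀ᵐ ω ∂μ, ω ∉ B n → |V n ω| ≤ (a * |U n ω| + C) * s n) :
    IsBigOPStar μ V s := by
  refine isBigOPStar_iff.2 fun ε hε => ?_
  obtain ⟨M, hM⟩ := isBigOPStar_iff.1 hU _ (half_pos hε)
  refine ⟨a * M + C, ?_⟩
  filter_upwards [hM, hV, hs, hB.eventually_lt_const (half_pos hε)] with n hMn hVn hsn hBn
  have hsub : ∀ᵐ ω ∂μ, (a * M + C) * s n < |V n ω| → ω ∈ {ω | M * 1 < |U n ω|} ∪ B n := by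
    filter_upwards [hVn] with ω hω hlt
    by_contra hmem
    obtain ⟨hUω, hBω⟩ := not_or.1 hmem
    rw [Set.mem_ofPred_eq, mul_one, not_lt] at hUω
    have hle : (a * |U n ω| + C) * s n ≤ (a * M + C) * s n := by gcongr
    exact (hlt.trans_le ((hω hBω).trans hle)).false
  have hreal : μ.real {ω | (a * M + C) * s n < |V n ω|} ≤ μ.real ({ω | M * 1 < |U n ω|} ∪ B n) :=
    ENNReal.toReal_mono (measure_ne_top _ _) (measure_mono_ae hsub)
  linarith [measureReal_union_le (μ := μ) {ω | M * 1 < |U n ω|} (B n)]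

theorem IsBigOPStar.of_rpow_le {U V : ℕ → Ω → ℝ} {r : ℕ → ℝ} (hU : IsBigOPStar μ U r)
    (hr : ∀ᶠ n in atTop, 0 ≤ r n) {κ α : ℝ} (hκ : 0 < κ) (hα : 0 < α) (hV : ∀ n ω, 0 ≤ V n ω)
    (hVU : ∀ n ω, α * V n ω ^ κ ≤ |U n ω|) : IsBigOPStar μ V fun n => r n ^ κ⁻¹ := by
  refine isBigOPStar_iff.2 fun ε hε => ?_
  obtain ⟨M, hM⟩ := isBigOPStar_iff.1 hU ε hε
  refine ⟨(|M| / α) ^ κ⁻¹, ?_⟩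
  filter_upwards [hM, hr] with n hn hrn
  refine (measureReal_mono fun ω hω => ?_).trans hn
  rw [Set.mem_ofPred_eq, abs_of_nonneg (hV n ω), ← Real.mul_rpow (by positivity) hrn,
    Real.rpow_inv_lt_iff_of_pos (by positivity) (hV n ω) hκ, div_mul_eq_mul_div,
    div_lt_iff₀' hα] at hω
  calc M * r n ≤ |M| * r n := by gcongr; exact le_abs_self M
    _ < α * V n ω ^ κ := hω
    _ ≤ |U n ω| := hVU n ω

end BoundedInProbability

/-! ### The infimum functional -/

section InfDeriv

variable {X : Type*} {f : X → ℝ}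

theorem EllInfty.abs_apply_le_norm (z : EllInfty X) (x : X) : |z x| ≤ ‖z‖ :=
  lp.norm_apply_le_norm ENNReal.top_ne_zero z x

theorem EllInfty.bddBelow_range_restrict (z : EllInfty X) (s : Set X) :
    BddBelow (Set.range fun x : s => z (x : X)) :=
  ⟨-‖z‖, Set.forall_mem_range.2 fun x => (abs_le.1 (z.abs_apply_le_norm x)).1⟩

theorem EllInfty.iInf_restrict_le_add_norm_sub {s : Set X} (hs : s.Nonempty) (z w : EllInfty X) :
    ⨅ x : s, z (x : X) ≤ (⨅ x : s, w (x : X)) + ‖z - w‖ := by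
  have := hs.to_subtype
  rw [← sub_le_iff_le_add]
  refine le_ciInf fun x => sub_le_iff_le_add'.2 ?_
  have hzw : z x - w x ≤ ‖z - w‖ := (le_abs_self _).trans ((z - w).abs_apply_le_norm x)
  linarith [ciInf_le (z.bddBelow_range_restrict s) x]

theorem EllInfty.iInf_restrict_le_norm {s : Set X} (hs : s.Nonempty) (z : EllInfty X) :
    ⨅ x : s, z (x : X) ≤ ‖z‖ := by
  obtain ⟨x, hx⟩ := hs
  exact (ciInf_le (z.bddBelow_range_restrict s) ⟨x, hx⟩).trans
    (abs_le.1 (z.abs_apply_le_norm x)).2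

theorem infVal_le (hf : BddBelow (Set.range f)) (x : X) : infVal f ≤ f x := ciInf_le hf x

/-- The functional `z ↦ lim_{ε ↓ 0} inf_{S^ε} z`, the directional derivative at `f` of the infimum
functional. As the infima increase when `ε` decreases, the limit is a supremum. -/
noncomputable def infDeriv (f : X → ℝ) (z : EllInfty X) : ℝ :=
  ⨆ ε : Set.Ioi (0 : ℝ), ⨅ x : nearMin f ε, z (x : X)

variable [Nonempty X]

theorem nearMin_nonempty {ε : ℝ} (hε : 0 < ε) : (nearMin f ε).Nonempty := by
  obtain ⟨x, hx⟩ := exists_lt_of_ciInf_lt (lt_add_of_pos_right (infVal f) hε)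
  exact ⟨x, hx.le⟩

theorem bddAbove_range_iInf_nearMin (z : EllInfty X) :
    BddAbove (Set.range fun ε : Set.Ioi (0 : ℝ) => ⨅ x : nearMin f ε, z (x : X)) :=
  ⟨‖z‖, Set.forall_mem_range.2 fun ε => z.iInf_restrict_le_norm (nearMin_nonempty ε.2)⟩

theorem iInf_nearMin_le_infDeriv {ε : ℝ} (hε : 0 < ε) (z : EllInfty X) :
    ⨅ x : nearMin f ε, z (x : X) ≤ infDeriv f z :=
  le_ciSup (bddAbove_range_iInf_nearMin z) (⟨ε, hε⟩ : Set.Ioi (0 : ℝ))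

theorem infDeriv_le_norm (z : EllInfty X) : infDeriv f z ≤ ‖z‖ :=
  ciSup_le fun ε => z.iInf_restrict_le_norm (nearMin_nonempty ε.2)

theorem tendsto_iInf_nearMin (z : EllInfty X) :
    Tendsto (fun ε : ℝ => ⨅ x : nearMin f ε, z (x : X)) (𝓝[>] 0) (𝓝 (infDeriv f z)) := by
  have hanti : AntitoneOn (fun ε : ℝ => ⨅ x : nearMin f ε, z (x : X)) (Set.Ioi 0) := by
    intro ε hε ε' _ hle
    have := (nearMin_nonempty (f := f) hε).to_subtype
    exact le_ciInf fun x => ciInf_le (z.bddBelow_range_restrict (nearMin f ε'))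
      ⟨x, x.2.trans (add_le_add_right hle _)⟩
  rw [infDeriv, ← sSup_image' (f := fun ε : ℝ => ⨅ x : nearMin f ε, z (x : X))]
  refine hanti.tendsto_nhdsGT ?_
  rw [Set.image_eq_range]
  exact bddAbove_range_iInf_nearMin z

theorem lipschitzWith_infDeriv : LipschitzWith 1 (infDeriv f) :=
  .of_le_add fun z w => ciSup_le fun ε => by
    rw [dist_eq_norm]
    exact (z.iInf_restrict_le_add_norm_sub (nearMin_nonempty ε.2) w).trans
      (add_le_add_left (iInf_nearMin_le_infDeriv ε.2 w) _)

end InfDeriv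

section PenalizedInf

variable {X : Type*} {f : X → ℝ} {c : ℝ}

/-- The infimum of `z` with the penalty `c (f - inf f)`. For `c > 0` this is the difference
quotient at `f` of the infimum functional, in the direction `z` and with step `1 / c`. -/
noncomputable def penalizedInf (f : X → ℝ) (c : ℝ) (z : EllInfty X) : ℝ :=
  ⨅ x, (c * (f x - infVal f) + z x)

theorem neg_norm_le_mul_sub_infVal_add (hf : BddBelow (Set.range f)) (hc : 0 ≤ c)
    (z : EllInfty X) (x : X) : -‖z‖ ≤ c * (f x - infVal f) + z x := by
  linarith [mul_nonneg hc (sub_nonneg.2 (infVal_le hf x)), abs_le.1 (z.abs_apply_le_norm x)]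

theorem penalizedInf_le_apply (hf : BddBelow (Set.range f)) (hc : 0 ≤ c)
    (z : EllInfty X) (x : X) : penalizedInf f c z ≤ c * (f x - infVal f) + z x :=
  ciInf_le ⟨-‖z‖, Set.forall_mem_range.2 (neg_norm_le_mul_sub_infVal_add hf hc z)⟩ x

variable [Nonempty X]

theorem penalizedInf_mono (hf : BddBelow (Set.range f)) (hc : 0 ≤ c) {d : ℝ} (hcd : c ≤ d)
    (z : EllInfty X) : penalizedInf f c z ≤ penalizedInf f d z :=
  le_ciInf fun x => (penalizedInf_le_apply hf hc z x).trans <| add_le_add_left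
    (mul_le_mul_of_nonneg_right hcd (sub_nonneg.2 (infVal_le hf x))) _

theorem lipschitzWith_penalizedInf (hf : BddBelow (Set.range f)) (hc : 0 ≤ c) :
    LipschitzWith 1 (penalizedInf f c) :=
  .of_le_add fun z w => by
    rw [dist_eq_norm, ← sub_le_iff_le_add]
    refine le_ciInf fun x => ?_
    have hzw : z x - w x ≤ ‖z - w‖ := (le_abs_self _).trans ((z - w).abs_apply_le_norm x)
    linarith [penalizedInf_le_apply hf hc z x]

theorem penalizedInf_le_add_iInf_nearMin (hf : BddBelow (Set.range f)) (hc : 0 ≤ c) {ε : ℝ}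
    (hε : 0 < ε) (z : EllInfty X) :
    penalizedInf f c z ≤ c * ε + ⨅ x : nearMin f ε, z (x : X) := by
  have := (nearMin_nonempty (f := f) hε).to_subtype
  rw [← sub_le_iff_le_add']
  exact le_ciInf fun x => sub_le_iff_le_add'.2 <| (penalizedInf_le_apply hf hc z x).trans <|
    add_le_add_left (mul_le_mul_of_nonneg_left (sub_le_iff_le_add'.2 x.2) hc) _

theorem penalizedInf_le_infDeriv (hf : BddBelow (Set.range f)) (hc : 0 ≤ c) (z : EllInfty X) :
    penalizedInf f c z ≤ infDeriv f z := by
  have hlim : Tendsto (fun ε => c * ε + infDeriv f z) (𝓝[>] 0) (𝓝 (c * 0 + infDeriv f z)) :=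
    ((tendsto_id.const_mul c).add_const _).mono_left nhdsWithin_le_nhds
  rw [mul_zero, zero_add] at hlim
  refine ge_of_tendsto hlim (eventually_mem_nhdsWithin.mono fun ε hε => ?_)
  exact (penalizedInf_le_add_iInf_nearMin hf hc hε z).trans
    (add_le_add_right (iInf_nearMin_le_infDeriv hε z) _)

/-- Off `S^ε` the penalty is at least `2 ‖z‖`, so such points do not lower the infimum. -/
theorem iInf_nearMin_le_penalizedInf (hf : BddBelow (Set.range f)) (hc : 0 ≤ c) {ε : ℝ}
    (hε : 0 < ε) {z : EllInfty X} (hz : 2 * ‖z‖ ≤ c * ε) :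
    ⨅ x : nearMin f ε, z (x : X) ≤ penalizedInf f c z := by
  refine le_ciInf fun x => ?_
  by_cases hx : x ∈ nearMin f ε
  · exact (ciInf_le (z.bddBelow_range_restrict _) ⟨x, hx⟩).trans
      (le_add_of_nonneg_left (mul_nonneg hc (sub_nonneg.2 (infVal_le hf x))))
  · have hlt : infVal f + ε < f x := not_le.1 hx
    have hpenalty : c * ε ≤ c * (f x - infVal f) :=
      mul_le_mul_of_nonneg_left (le_sub_iff_add_le'.2 hlt.le) hc
    linarith [z.iInf_restrict_le_norm (nearMin_nonempty (f := f) hε),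
      abs_le.1 (z.abs_apply_le_norm x)]

theorem tendsto_penalizedInf (hf : BddBelow (Set.range f)) (z : EllInfty X) :
    Tendsto (fun c => penalizedInf f c z) atTop (𝓝 (infDeriv f z)) := by
  refine tendsto_order.2 ⟨fun a ha => ?_, fun b hb => ?_⟩
  · obtain ⟨ε, haε, hε⟩ := (((tendsto_iInf_nearMin z).eventually_const_lt ha).and
      eventually_mem_nhdsWithin).exists
    filter_upwards [eventually_ge_atTop 0, eventually_ge_atTop (2 * ‖z‖ / ε)] with c hc hcε
    exact haε.trans_le (iInf_nearMin_le_penalizedInf hf hc hε ((div_le_iff₀ hε).1 hcε))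
  · filter_upwards [eventually_ge_atTop 0] with c hc
    exact (penalizedInf_le_infDeriv hf hc z).trans_lt hb

theorem penalizedInf_eq_mul_sub {g : X → ℝ} (hf : BddBelow (Set.range f))
    (hg : BddBelow (Set.range g)) (hc : 0 < c) {z : EllInfty X}
    (hz : ∀ x, z x = c * (g x - f x)) :
    penalizedInf f c z = c * (infVal g - infVal f) := by
  apply le_antisymm
  · rw [← div_le_iff₀' hc, le_sub_iff_add_le]
    refine le_ciInf fun x => ?_
    rw [← le_sub_iff_add_le, div_le_iff₀' hc]
    linarith [penalizedInf_le_apply hf hc.le z x, hz x]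
  · refine le_ciInf fun x => ?_
    rw [hz x]
    linarith [mul_le_mul_of_nonneg_left (infVal_le hg x) hc.le]

end PenalizedInf

section ScaledDeviation

variable {X : Type*} {f g : X → ℝ} {c : ℝ}

theorem toEllInfty_apply (hg : Memℓp g ⊤) (x : X) : toEllInfty g x = g x := by
  rw [toEllInfty, dif_pos hg]

theorem bddBelow_range_of_memℓp (hg : Memℓp g ⊤) : BddBelow (Set.range g) := by
  obtain ⟨C, hC⟩ := hg.bddAbove
  exact ⟨-C, Set.forall_mem_range.2 fun x => (abs_le.1 (hC ⟨x, rfl⟩)).1⟩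

/-- The deviation `c (g - f)` as an element of `ℓ^∞(X)`; it is meant for bounded `g - f`. -/
noncomputable def scaledDeviation (c : ℝ) (f g : X → ℝ) : EllInfty X :=
  toEllInfty fun x => c * (g x - f x)

theorem scaledDeviation_apply (hgf : Memℓp (fun x => g x - f x) ⊤) (x : X) :
    scaledDeviation c f g x = c * (g x - f x) :=
  toEllInfty_apply (hgf.const_smul c) x

theorem bddBelow_range_of_memℓp_sub (hf : BddBelow (Set.range f))
    (hgf : Memℓp (fun x => g x - f x) ⊤) : BddBelow (Set.range g) := by
  simpa only [add_sub_cancel] using hf.range_add (bddBelow_range_of_memℓp hgf)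

variable [Nonempty X]

theorem penalizedInf_scaledDeviation (hf : BddBelow (Set.range f))
    (hgf : Memℓp (fun x => g x - f x) ⊤) (hc : 0 < c) :
    penalizedInf f c (scaledDeviation c f g) = c * (infVal g - infVal f) :=
  penalizedInf_eq_mul_sub hf (bddBelow_range_of_memℓp_sub hf hgf) hc (scaledDeviation_apply hgf)

theorem mul_sub_infVal_le_of_mem_nearMin (hf : BddBelow (Set.range f))
    (hgf : Memℓp (fun x => g x - f x) ⊤) (hc : 0 < c) {δ : ℝ} {x : X} (hx : x ∈ nearMin g δ) :
    c * (f x - infVal f) ≤ 2 * ‖scaledDeviation c f g‖ + c * δ := by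
  have hinf : c * (infVal g - infVal f) ≤ ‖scaledDeviation c f g‖ := by
    rw [← penalizedInf_scaledDeviation hf hgf hc]
    exact (penalizedInf_le_infDeriv hf hc.le _).trans (infDeriv_le_norm _)
  have hdev : c * (f x - g x) ≤ ‖scaledDeviation c f g‖ := by
    linarith [abs_le.1 ((scaledDeviation c f g).abs_apply_le_norm x),
      scaledDeviation_apply (c := c) hgf x]
  have hmin : c * g x ≤ c * (infVal g + δ) := mul_le_mul_of_nonneg_left hx hc.le
  linarith

end ScaledDeviation

/-! ### Convergence rates of infima and near-minimizers -/

section Rates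

variable {Ω Ω' X : Type*} [MeasurableSpace Ω] [MeasurableSpace Ω'] [Nonempty X] {μ : Measure Ω}
  [IsFiniteMeasure μ] {ν : Measure Ω'} [IsFiniteMeasure ν] {c : ℕ → ℝ}

theorem HJWeakConv.isBigOPStar_inv {U : ℕ → Ω → ℝ} {L : Ω' → ℝ}
    (hU : HJWeakConv μ (fun n ω => c n * U n ω) ν L) (hc : Tendsto c atTop atTop) :
    IsBigOPStar μ U fun n => (c n)⁻¹ := by
  refine hU.isBigOPStar_norm.of_abs_le (a := 1) (C := 0) (B := fun _ => ∅) ?_ zero_le_one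
    (by simp) ?_
  · exact (hc.eventually_ge_atTop 0).mono fun n hn => inv_nonneg.2 hn
  · filter_upwards [hc.eventually_gt_atTop 0] with n hn
    refine .of_forall fun ω _ => le_of_eq ?_
    rw [abs_norm, norm_mul, Real.norm_of_nonneg hn.le, Real.norm_eq_abs]
    field_simp
    ring

variable {f : X → ℝ} {F : ℕ → Ω → X → ℝ} {G : Ω' → EllInfty X}

theorem HJWeakConv.mul_infVal_sub
    (hG : HJWeakConv μ (fun n ω => scaledDeviation (c n) f (F n ω)) ν G)
    (hc : Tendsto c atTop atTop) (hf : BddBelow (Set.range f))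
    (hF : ∀ᶠ n in atTop, ∀ᵐ ω ∂μ, Memℓp (fun x => F n ω x - f x) ⊤) :
    HJWeakConv μ (fun n ω => c n * (infVal (F n ω) - infVal f)) ν
      fun ω' => infDeriv f (G ω') := by
  refine hG.of_eventually_mem_segment (Φ := fun m : ℕ => penalizedInf f m)
    (fun m => (lipschitzWith_penalizedInf hf m.cast_nonneg).continuous)
    lipschitzWith_infDeriv.continuous
    (fun z => (tendsto_penalizedInf hf z).comp tendsto_natCast_atTop_atTop) fun m => ?_
  filter_upwards [hF, hc.eventually_gt_atTop 0, hc.eventually_ge_atTop m] with n hn hcn hmn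
  filter_upwards [hn] with ω hω
  rw [segment_eq_Icc (penalizedInf_le_infDeriv hf m.cast_nonneg _),
    ← penalizedInf_scaledDeviation hf hω hcn]
  exact ⟨penalizedInf_mono hf m.cast_nonneg hmn _, penalizedInf_le_infDeriv hf hcn.le _⟩

theorem HJWeakConv.isBigOPStar_sub_infVal
    (hG : HJWeakConv μ (fun n ω => scaledDeviation (c n) f (F n ω)) ν G)
    (hc : Tendsto c atTop atTop) (hf : BddBelow (Set.range f))
    (hF : ∀ᶠ n in atTop, ∀ᵐ ω ∂μ, Memℓp (fun x => F n ω x - f x) ⊤)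
    {δ : ℕ → ℝ} {xhat : ℕ → Ω → X} (hδ : δ =O[atTop] fun n => (c n)⁻¹)
    (hxhat : Tendsto (fun n => μ.real {ω | xhat n ω ∉ nearMin (F n ω) (δ n)}) atTop (𝓝 0)) :
    IsBigOPStar μ (fun n ω => f (xhat n ω) - infVal f) fun n => (c n)⁻¹ := by
  obtain ⟨C, hC⟩ := hδ.bound
  refine hG.isBigOPStar_norm.of_abs_le (a := 2) (C := C) ?_ zero_le_two hxhat ?_
  · exact (hc.eventually_ge_atTop 0).mono fun n hn => inv_nonneg.2 hn
  · filter_upwards [hF, hC, hc.eventually_gt_atTop 0] with n hFn hCn hcn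
    filter_upwards [hFn] with ω hω hmem
    have hcδ : c n * δ n ≤ C := by
      rw [Real.norm_of_nonneg (inv_nonneg.2 hcn.le), ← div_eq_mul_inv, le_div_iff₀' hcn] at hCn
      exact (mul_le_mul_of_nonneg_left (Real.le_norm_self _) hcn.le).trans hCn
    rw [abs_norm, abs_of_nonneg (sub_nonneg.2 (infVal_le hf _)), ← div_eq_mul_inv,
      le_div_iff₀' hcn]
    exact (mul_sub_infVal_le_of_mem_nearMin hf hω hcn (not_not.1 hmem)).trans
      (add_le_add_right hcδ _)

theorem mainTheorem5_general (hc : Tendsto c atTop atTop) (hf : BddBelow (Set.range f))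
    (hF : ∀ᶠ n in atTop, ∀ᵐ ω ∂μ, Memℓp (fun x => F n ω x - f x) ⊤)
    (hG : HJWeakConv μ (fun n ω => scaledDeviation (c n) f (F n ω)) ν G) :
    (∃ L : Ω' → ℝ,
      (∀ ω', Tendsto (fun ε : ℝ => ⨅ x : nearMin f ε, G ω' (x : X)) (𝓝[>] 0) (𝓝 (L ω'))) ∧
      HJWeakConv μ (fun n ω => c n * (infVal (F n ω) - infVal f)) ν L) ∧
    IsBigOPStar μ (fun n ω => infVal (F n ω) - infVal f) (fun n => (c n)⁻¹) ∧
    ∀ (δ : ℕ → ℝ) (xhat : ℕ → Ω → X), (δ =O[atTop] fun n => (c n)⁻¹) →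
      Tendsto (fun n => μ.real {ω | xhat n ω ∉ nearMin (F n ω) (δ n)}) atTop (𝓝 0) →
      IsBigOPStar μ (fun n ω => f (xhat n ω) - infVal f) (fun n => (c n)⁻¹) ∧
      ∀ (ρ : X → ℝ) (κ α : ℝ), (∀ x, 0 ≤ ρ x) → 0 < κ → 0 < α →
        (∀ x, α * ρ x ^ κ ≤ f x - infVal f) →
        IsBigOPStar μ (fun n ω => ρ (xhat n ω)) (fun n => (c n)⁻¹ ^ κ⁻¹) := by
  have hW := hG.mul_infVal_sub hc hf hF
  refine ⟨⟨_, fun ω' => tendsto_iInf_nearMin (G ω'), hW⟩, hW.isBigOPStar_inv hc,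
    fun δ xhat hδ hxhat => ?_⟩
  have hvalue := hG.isBigOPStar_sub_infVal hc hf hF hδ hxhat
  refine ⟨hvalue, fun ρ κ α hρ hκ hα hgrowth => ?_⟩
  exact hvalue.of_rpow_le ((hc.eventually_ge_atTop 0).mono fun n hn => inv_nonneg.2 hn) hκ hα
    (fun n ω => hρ _) fun n ω => (hgrowth _).trans (le_abs_self _)

end Rates

theorem EmpMinMembership.tendsto_measureReal_notMem {Ω Ξ X : Type*} [MeasurableSpace Ω]
    {μ : Measure Ω} [IsProbabilityMeasure μ] {h : X → Ξ → ℝ} {ξ : ℕ → Ω → Ξ} {δ : ℕ → ℝ}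
    {xhat : ℕ → Ω → X} (hmin : EmpMinMembership μ h ξ δ xhat) :
    Tendsto (fun n => μ.real {ω | xhat n ω ∉ nearMin (empObj h ξ n ω) (δ n)}) atTop (𝓝 0) := by
  obtain ⟨A, hAm, hA, hAμ, hmem⟩ := hmin
  have hμA : Tendsto (fun n => μ.real (A n)) atTop (𝓝 1) := by
    have hunion := tendsto_measure_iUnion_atTop (μ := μ) (monotone_nat_of_le_succ hA)
    rw [hAμ] at hunion
    exact (ENNReal.tendsto_toReal ENNReal.one_ne_top).comp hunion
  have hcompl : Tendsto (fun n => μ.real (A n)ᶜ) atTop (𝓝 0) := by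
    simpa only [probReal_compl_eq_one_sub (hAm _), sub_self] using hμA.const_sub 1
  exact squeeze_zero (fun n => measureReal_nonneg)
    (fun n => measureReal_mono fun ω hω hωA => hω (hmem n ω hωA n le_rfl)) hcompl

theorem rpow_neg_half_eq_inv_sqrt {x : ℝ} (hx : 0 ≤ x) : x ^ (-(1 / 2) : ℝ) = (√x)⁻¹ := by
  rw [Real.rpow_neg hx, Real.sqrt_eq_rpow]

theorem rpow_neg_inv_two_mul_eq {x : ℝ} (hx : 0 ≤ x) (κ : ℝ) :
    x ^ (-(1 / (2 * κ)) : ℝ) = (√x)⁻¹ ^ κ⁻¹ := by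
  rw [← rpow_neg_half_eq_inv_sqrt hx, ← Real.rpow_mul hx]
  ring_nf

theorem mainTheorem5
    {Ω Ω' Ξ X : Type*} [MeasurableSpace Ω] [MeasurableSpace Ω'] [MeasurableSpace Ξ] [Nonempty X]
    (μ : Measure Ω) [IsProbabilityMeasure μ]
    (ν : Measure Ω') [IsProbabilityMeasure ν]
    -- the i.i.d. sample with law `P`
    (P : Measure Ξ) (ξ : ℕ → Ω → Ξ)
    (hξ_meas : ∀ i, Measurable (ξ i))
    (hξ_indep : iIndepFun ξ μ)
    (hξ_law : ∀ i, μ.map (ξ i) = P)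
    -- the loss
    (h : X → Ξ → ℝ)
    (hh_meas : ∀ x, Measurable (h x))
    (hh_int : ∀ x, Integrable (h x) P)
    -- `f` is bounded; for all large `n` the empirical objective is almost surely bounded
    (hf : Memℓp (expObj h P) ⊤)
    (hfhat : ∀ᶠ n in atTop, ∀ᵐ ω ∂μ, Memℓp (empObj h ξ n ω) ⊤)
    -- `√n (f̂_n - f) ⇝ G` in `ℓ^∞(X)`
    (G : Ω' → EllInfty X)
    (hG : HJWeakConv μ
      (fun n ω => toEllInfty fun x => √(n : ℝ) * (empObj h ξ n ω x - expObj h P x)) ν G) :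
    -- the limit in `ε ↓ 0` exists, and `√n (ψ̂_n - ψ*)` converges weakly to it
    (∃ L : Ω' → ℝ,
      (∀ ω', Tendsto (fun ε : ℝ => ⨅ x : nearMin (expObj h P) ε, G ω' (x : X))
        (𝓝[>] 0) (𝓝 (L ω'))) ∧
      HJWeakConv μ
        (fun n ω => √(n : ℝ) * (infVal (empObj h ξ n ω) - infVal (expObj h P))) ν L) ∧
    IsBigOPStar μ (fun n ω => infVal (empObj h ξ n ω) - infVal (expObj h P))
      (fun n => (n : ℝ) ^ (-(1 / 2) : ℝ)) ∧
    ∀ (δ : ℕ → ℝ) (xhat : ℕ → Ω → X), (∀ n, 0 ≤ δ n) →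
      (δ =O[atTop] fun n => (n : ℝ) ^ (-(1 / 2) : ℝ)) →
      EmpMinMembership μ h ξ δ xhat →
      IsBigOPStar μ (fun n ω => expObj h P (xhat n ω) - infVal (expObj h P))
        (fun n => (n : ℝ) ^ (-(1 / 2) : ℝ)) ∧
      -- now `X` is a subset of `ℝ^d`, with inclusion `e`
      ∀ (d : ℕ) (e : X → EuclideanSpace ℝ (Fin d)), Function.Injective e →
        ∀ κ : ℝ, SharpGrowth e (expObj h P) κ →
          IsBigOPStar μ
            (fun n ω => Metric.infDist (e (xhat n ω)) (e '' nearMin (expObj h P) 0))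
            (fun n => (n : ℝ) ^ (-(1 / (2 * κ)) : ℝ)) := by
  simp only [rpow_neg_half_eq_inv_sqrt (Nat.cast_nonneg _),
    rpow_neg_inv_two_mul_eq (Nat.cast_nonneg _)]
  have hsqrt : Tendsto (fun n : ℕ => √(n : ℝ)) atTop atTop :=
    Real.tendsto_sqrt_atTop.comp tendsto_natCast_atTop_atTop
  obtain ⟨hlimit, hinf, hmin⟩ := mainTheorem5_general hsqrt (bddBelow_range_of_memℓp hf)
    (hfhat.mono fun n hn => hn.mono fun ω hω => hω.sub hf) hG
  refine ⟨hlimit, hinf, fun δ xhat _ hδ hmem => ?_⟩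
  obtain ⟨hvalue, hdist⟩ := hmin δ xhat hδ hmem.tendsto_measureReal_notMem
  exact ⟨hvalue, fun d e _ κ ⟨hκ, _, α, hα, hgrowth⟩ => hdist
    (fun x => Metric.infDist (e x) (e '' nearMin (expObj h P) 0)) κ α
    (fun x => Metric.infDist_nonneg) (zero_lt_one.trans_le hκ) hα hgrowth⟩
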